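/- Fill each cell of an $n\times n$ chessboard ($n\ge 1$) with an integer. Two distinct cells are called neighbours if they share a common edge or a common vertex (so neighbours are the cells a chess king can reach in one move; cells $(i,j)\neq(i',j')$ are neighbours exactly when $|i-i'|\le 1$ and $|j-j'|\le 1$). The filling has the neighbour-sum property if the number on every cell is equal to the sum of the numbers on its neighbours. **Theorem.** For every integer $n\ge 1$, there is a filling of the $n\times n$ chessboard by integers, not all zero, that has the neighbour-sum property if and only if $6\mid n+1$. -/

import Mathlib

/-- The King's graph on the cells `(i, j)` of an `n × n` chessboard (Moore neighbourhood): two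
distinct cells are neighbours when they share a common edge or a common vertex, that is, when
their row indices differ by at most one and their column indices differ by at most one. -/
def kingGraph (n : ℕ) : SimpleGraph (Fin n × Fin n) where
  Adj c d := c ≠ d ∧ |(c.1 : ℤ) - (d.1 : ℤ)| ≤ 1 ∧ |(c.2 : ℤ) - (d.2 : ℤ)| ≤ 1
  symm := ⟨by
    intro c d h
    exact ⟨h.1.symm, by rw [abs_sub_comm]; exact h.2.1, by rw [abs_sub_comm]; exact h.2.2⟩⟩
  loopless := ⟨fun _ h => h.1 rfl⟩

instance kingGraph.decidableAdj (n : ℕ) : DecidableRel (kingGraph n).Adj := fun c d =>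
  inferInstanceAs
    (Decidable (c ≠ d ∧ |(c.1 : ℤ) - (d.1 : ℤ)| ≤ 1 ∧ |(c.2 : ℤ) - (d.2 : ℤ)| ≤ 1))

/-- An integer filling `X` of the `n × n` chessboard is a solution of the neighbour-sum property
if the number on every cell is the sum of the numbers on the neighbouring cells. -/
def HasNeighbourSumProperty {n : ℕ} (X : Matrix (Fin n) (Fin n) ℤ) : Prop :=
  ∀ i j : Fin n, X i j = ∑ d ∈ (kingGraph n).neighborFinset (i, j), X d.1 d.2

/-! With B the band matrix, the property reads B X B = 2X, so a nonzero solution makes 2 a product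
of two complex eigenvalues 1 + ζ + ζ⁻¹ and 1 + η + η⁻¹ of B, where ζ and η are 2(n+1)-th roots of
unity. Galois conjugation preserves this relation (`conjugate_product_eq_two`), and since each
factor lies in [-1, 3], no conjugate of ζ or η has real part below -1/6. This leaves orders 1, 4, 6
(`orderOf_of_forall_re`), with values 3, 1, 2. Only 1 · 2 gives 2, so 12 divides 2(n+1). Conversely,
the outer product of eigenvectors for 2 and 1 is a solution. -/

open Matrix Polynomial

/-! ### The board and the band matrix -/

/-- The `0`-`1` matrix of the relation `|i - j| ≤ 1` on `Fin n`. -/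
def bandMatrix (n : ℕ) (R : Type*) [Zero R] [One R] : Matrix (Fin n) (Fin n) R :=
  Matrix.of fun i j => if |(i : ℤ) - (j : ℤ)| ≤ 1 then 1 else 0

theorem bandMatrix_transpose (n : ℕ) (R : Type*) [Zero R] [One R] :
    (bandMatrix n R)ᵀ = bandMatrix n R := by
  ext i j
  simp [bandMatrix, abs_sub_comm]

theorem bandMatrix_map_intCast (n : ℕ) (R : Type*) [Ring R] :
    (bandMatrix n ℤ).map (Int.castRingHom R) = bandMatrix n R := by
  ext i j
  simp only [bandMatrix, Matrix.map_apply, Matrix.of_apply]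
  split_ifs <;> simp

/-- Zeros at positions 0 and n + 1 give the boundary rows the same three-term form as the others. -/
theorem bandMatrix_mulVec_apply {n : ℕ} {R : Type*} [CommRing R] (f : ℕ → R) (h0 : f 0 = 0)
    (hn : f (n + 1) = 0) (i : Fin n) :
    (bandMatrix n R *ᵥ fun k => f (k + 1)) i = f i + f (i + 1) + f (i + 2) := by
  have hi := i.2
  let g : ℕ → R := fun j => if |((i : ℕ) + 1 : ℤ) - (j : ℤ)| ≤ 1 then f j else 0
  have h1 : (bandMatrix n R *ᵥ fun k => f (k + 1)) i = ∑ k ∈ Finset.range n, g (k + 1) := by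
    rw [← Fin.sum_univ_eq_sum_range (fun k => g (k + 1))]
    simp only [Matrix.mulVec, dotProduct, bandMatrix, Matrix.of_apply, ite_mul, one_mul, zero_mul]
    refine Finset.sum_congr rfl fun k _ => ?_
    simp [g]
  have g0 : g 0 = 0 := by simp [g, h0]
  have gn : g (n + 1) = 0 := by simp only [g, hn, ite_self]
  have h2 : ∑ k ∈ Finset.range n, g (k + 1) = ∑ k ∈ Finset.range (n + 2), g k := by
    rw [Finset.sum_range_succ, Finset.sum_range_succ', g0, gn, add_zero, add_zero]
  have h3 : ∑ k ∈ Finset.range (n + 2), g k =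
      ∑ k ∈ ({(i : ℕ), (i : ℕ) + 1, (i : ℕ) + 2} : Finset ℕ), g k := by
    symm
    apply Finset.sum_subset
    · intro k hk
      simp only [Finset.mem_insert, Finset.mem_singleton] at hk
      rw [Finset.mem_range]
      omega
    · intro k _ hk
      simp only [Finset.mem_insert, Finset.mem_singleton] at hk
      simp only [g]
      rw [if_neg]
      rw [abs_le]
      omega
  rw [h1, h2, h3, Finset.sum_insert (by simp), Finset.sum_insert (by simp),
    Finset.sum_singleton]
  simp only [g]
  rw [if_pos (by rw [abs_le]; omega), if_pos (by rw [abs_le]; omega),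
    if_pos (by rw [abs_le]; omega), add_assoc]

/-- Two-sided multiplication sums over the 3 × 3 block, which contains the cell itself; hence the 2.
-/
theorem hasNeighbourSumProperty_iff {n : ℕ} (X : Matrix (Fin n) (Fin n) ℤ) :
    HasNeighbourSumProperty X ↔ bandMatrix n ℤ * X * bandMatrix n ℤ = (2 : ℤ) • X := by
  have key : ∀ i j, (bandMatrix n ℤ * X * bandMatrix n ℤ) i j =
      X i j + ∑ d ∈ (kingGraph n).neighborFinset (i, j), X d.1 d.2 := by
    intro i j
    have h1 : (bandMatrix n ℤ * X * bandMatrix n ℤ) i j =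
        ∑ d : Fin n × Fin n,
          if |(i : ℤ) - (d.1 : ℤ)| ≤ 1 ∧ |(j : ℤ) - (d.2 : ℤ)| ≤ 1 then X d.1 d.2 else 0 := by
      simp only [Matrix.mul_apply, Finset.sum_mul, Fintype.sum_prod_type]
      rw [Finset.sum_comm]
      refine Finset.sum_congr rfl fun k _ => Finset.sum_congr rfl fun l _ => ?_
      simp only [bandMatrix, Matrix.of_apply]
      rw [abs_sub_comm (l : ℤ) (j : ℤ)]
      split_ifs <;> simp_all
    rw [h1, ← Finset.sum_filter]
    have h2 : Finset.univ.filter (fun d : Fin n × Fin n =>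
          |(i : ℤ) - (d.1 : ℤ)| ≤ 1 ∧ |(j : ℤ) - (d.2 : ℤ)| ≤ 1) =
        insert (i, j) ((kingGraph n).neighborFinset (i, j)) := by
      ext d
      rw [Finset.mem_filter, Finset.mem_insert, SimpleGraph.mem_neighborFinset]
      simp only [Finset.mem_univ, true_and, kingGraph]
      by_cases h : d = (i, j)
      · subst h; simp
      · simp [h, Ne.symm h]
    rw [h2, Finset.sum_insert (by simp)]
  constructor
  · intro h
    ext i j
    rw [key, ← h i j, Matrix.smul_apply, smul_eq_mul, two_mul]
  · intro h i j
    have := key i j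
    rw [h, Matrix.smul_apply, smul_eq_mul] at this
    linarith

/-! ### Eigenvalues -/

/-- Every eigenvalue of the band matrix is `1 + ζ + ζ⁻¹` for a `2(n+1)`-th root of unity `ζ`. -/
theorem exists_root_of_unity_of_bandMatrix_mulVec {n : ℕ} {v : Fin n → ℂ} {c : ℂ} (hv : v ≠ 0)
    (h : bandMatrix n ℂ *ᵥ v = c • v) :
    ∃ ζ : ℂ, ζ ^ (2 * (n + 1)) = 1 ∧ c = 1 + ζ + ζ⁻¹ := by
  obtain ⟨ζ, hζ⟩ := IsAlgClosed.exists_root (X ^ 2 + C (1 - c) * X + C 1 : ℂ[X])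
    (by
      have : (X ^ 2 + C (1 - c) * X + C 1 : ℂ[X]).degree = 2 := by compute_degree!
      rw [this]; decide)
  have hζ : ζ ^ 2 + (1 - c) * ζ + 1 = 0 := by simpa [IsRoot] using hζ
  have ζ0 : ζ ≠ 0 := by
    rintro rfl
    norm_num at hζ
  have hc : c = 1 + ζ + ζ⁻¹ := by
    field_simp
    linear_combination -hζ
  refine ⟨ζ, ?_, hc⟩
  let f : ℕ → ℂ := fun k => if hk : 0 < k ∧ k ≤ n then v ⟨k - 1, by omega⟩ else 0
  have f0 : f 0 = 0 := by simp [f]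
  have fn : f (n + 1) = 0 := by simp [f]
  have fv : (fun k : Fin n => f (k + 1)) = v := by
    ext k
    have := k.2
    simp only [f]
    rw [dif_pos (by omega)]
    simp
  have hrec : ∀ i < n, f (i + 2) = (ζ + ζ⁻¹) * f (i + 1) - f i := by
    intro i hi
    have h1 := bandMatrix_mulVec_apply f f0 fn ⟨i, hi⟩
    rw [fv, h, ← fv, hc] at h1
    simp only [Pi.smul_apply, smul_eq_mul] at h1
    linear_combination -h1
  -- The factor ζ - ζ⁻¹ is kept on the left, so ζ = ±1 needs no separate case.
  have sol : ∀ i ≤ n, (ζ - ζ⁻¹) * f i = f 1 * (ζ ^ i - ζ⁻¹ ^ i) ∧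
      (ζ - ζ⁻¹) * f (i + 1) = f 1 * (ζ ^ (i + 1) - ζ⁻¹ ^ (i + 1)) := by
    intro i
    induction i with
    | zero => intro _; simp [f0, mul_comm]
    | succ i ih =>
      intro hi
      obtain ⟨h1, h2⟩ := ih (by omega)
      refine ⟨h2, ?_⟩
      rw [hrec i (by omega)]
      have hinv : ζ * ζ⁻¹ = 1 := mul_inv_cancel₀ ζ0
      linear_combination (ζ + ζ⁻¹) * h2 - h1 + f 1 * (ζ ^ i - ζ⁻¹ ^ i) * hinv
  have f1 : f 1 ≠ 0 := by
    intro f1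
    apply hv
    have hz : ∀ i ≤ n, f i = 0 ∧ f (i + 1) = 0 := by
      intro i
      induction i with
      | zero => intro _; exact ⟨f0, f1⟩
      | succ i ih =>
        intro hi
        obtain ⟨h1, h2⟩ := ih (by omega)
        refine ⟨h2, ?_⟩
        rw [hrec i (by omega), h1, h2]
        simp
    rw [← fv]
    ext k
    exact (hz k k.2.le).2
  have hend := (sol n le_rfl).2
  rw [fn, mul_zero, eq_comm, mul_eq_zero, or_iff_right f1, sub_eq_zero, inv_pow] at hend
  rw [two_mul, pow_add]
  nth_rewrite 1 [hend]
  exact inv_mul_cancel₀ (pow_ne_zero _ ζ0)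

/-- Left multiplication by B preserves the 2-eigenspace of Y ↦ B Y B. An eigenvector Y there has a
nonzero column and row that are eigenvectors of B for c and 2/c. -/
theorem exists_roots_of_unity_of_band_eq {n : ℕ} {X : Matrix (Fin n) (Fin n) ℂ} (hX : X ≠ 0)
    (h : bandMatrix n ℂ * X * bandMatrix n ℂ = (2 : ℂ) • X) :
    ∃ ζ η : ℂ, ζ ^ (2 * (n + 1)) = 1 ∧ η ^ (2 * (n + 1)) = 1 ∧
      (1 + ζ + ζ⁻¹) * (1 + η + η⁻¹) = 2 := by
  set B := bandMatrix n ℂ with hB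
  let L : Module.End ℂ (Matrix (Fin n) (Fin n) ℂ) := LinearMap.mulLeft ℂ B
  let T : Module.End ℂ (Matrix (Fin n) (Fin n) ℂ) := LinearMap.mulRight ℂ B ∘ₗ L
  let E := T.eigenspace 2
  have hE : ∀ Y, Y ∈ E ↔ B * Y * B = (2 : ℂ) • Y := fun Y => Module.End.mem_eigenspace_iff
  have hL : ∀ Y ∈ E, L Y ∈ E := by
    intro Y hY
    rw [hE] at hY ⊢
    simp only [L, LinearMap.mulLeft_apply]
    rw [Matrix.mul_assoc B (B * Y) B, hY, Matrix.mul_smul]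
  have : Nontrivial E := ⟨⟨X, (hE X).2 h⟩, 0, fun e => hX (congrArg Subtype.val e)⟩
  obtain ⟨c, hc⟩ := Module.End.exists_eigenvalue (L.restrict hL)
  obtain ⟨Y, hY⟩ := hc.exists_hasEigenvector
  have hY1 : B * Y.1 = c • Y.1 := congrArg Subtype.val hY.apply_eq_smul
  have hY0 : Y.1 ≠ 0 := fun e => hY.2 (Subtype.ext e)
  have hY2 : c • (Y.1 * B) = (2 : ℂ) • Y.1 := by
    rw [← Matrix.smul_mul, ← hY1]
    exact (hE _).1 Y.2
  have c0 : c ≠ 0 := by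
    rintro rfl
    rw [zero_smul, eq_comm, smul_eq_zero] at hY2
    simp_all
  have hY3 : Y.1 * B = (c⁻¹ * 2) • Y.1 := by
    rw [mul_smul, ← hY2, smul_smul, inv_mul_cancel₀ c0, one_smul]
  obtain ⟨i, j, hij⟩ : ∃ i j, Y.1 i j ≠ 0 := by
    by_contra! hh
    exact hY0 (Matrix.ext hh)
  obtain ⟨ζ, hζ, hcζ⟩ := exists_root_of_unity_of_bandMatrix_mulVec (n := n)
    (v := fun k => Y.1 k j) (c := c) (fun e => hij (congrFun e i)) (by
      ext k
      exact congrFun (congrFun hY1 k) j)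
  obtain ⟨η, hη, hcη⟩ := exists_root_of_unity_of_bandMatrix_mulVec (n := n)
    (v := fun k => Y.1 i k) (c := c⁻¹ * 2) (fun e => hij (congrFun e j)) (by
      rw [← bandMatrix_transpose, Matrix.mulVec_transpose]
      ext k
      exact congrFun (congrFun hY3 i) k)
  refine ⟨ζ, η, hζ, hη, ?_⟩
  rw [← hcζ, ← hcη, mul_inv_cancel_left₀ c0]

/-! ### Galois conjugation and orders -/

/-- ω and ω ^ k share a minimal polynomial over ℤ, so the relation, made polynomial by z⁻¹ = z ^ (N
- 1), passes from one to the other. -/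
theorem conjugate_product_eq_two {N : ℕ} (hN : 0 < N) {ζ η : ℂ} (hζ : ζ ^ N = 1) (hη : η ^ N = 1)
    (h : (1 + ζ + ζ⁻¹) * (1 + η + η⁻¹) = 2) {k : ℕ} (hk : k.Coprime N) :
    (1 + ζ ^ k + (ζ ^ k)⁻¹) * (1 + η ^ k + (η ^ k)⁻¹) = 2 := by
  have : NeZero N := ⟨hN.ne'⟩
  have hω := Complex.isPrimitiveRoot_exp N hN.ne'
  set ω := Complex.exp (2 * Real.pi * Complex.I / N)
  obtain ⟨s, -, rfl⟩ := hω.eq_pow_of_pow_eq_one hζ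
  obtain ⟨t, -, rfl⟩ := hω.eq_pow_of_pow_eq_one hη
  have inv_eq : ∀ z : ℂ, z ^ N = 1 → z⁻¹ = z ^ (N - 1) := by
    intro z hz
    apply inv_eq_of_mul_eq_one_right
    rw [← pow_succ', Nat.sub_add_cancel hN, hz]
  let P : ℤ[X] := (1 + X ^ s + (X ^ s) ^ (N - 1)) * (1 + X ^ t + (X ^ t) ^ (N - 1)) - 2
  have hP : aeval ω P = 0 := by
    rw [inv_eq _ hζ, inv_eq _ hη] at h
    simp only [P, map_sub, map_mul, map_add, map_pow, map_one, map_ofNat, aeval_X, h, sub_self]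
  have hdvd := minpoly.isIntegrallyClosed_dvd (hω.isIntegral hN) hP
  rw [hω.minpoly_eq_pow_coprime hk] at hdvd
  obtain ⟨Q, hQ⟩ := hdvd
  have hP' : aeval (ω ^ k) P = 0 := by
    rw [hQ, map_mul, minpoly.aeval, zero_mul]
  have comm : ∀ r, (ω ^ r) ^ k = (ω ^ k) ^ r := fun r => by rw [← pow_mul, ← pow_mul, mul_comm]
  have pow_one' : ∀ r, ((ω ^ k) ^ r) ^ N = 1 := fun r => by
    rw [pow_right_comm (ω ^ k), pow_right_comm ω, hω.pow_eq_one, one_pow, one_pow]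
  rw [comm, comm, inv_eq _ (pow_one' s), inv_eq _ (pow_one' t)]
  simpa only [P, map_sub, map_mul, map_add, map_pow, map_one, map_ofNat, aeval_X,
    sub_eq_zero] using hP'

theorem one_add_add_inv_eq_ofReal {z : ℂ} (hz : ‖z‖ = 1) :
    1 + z + z⁻¹ = ((1 + 2 * z.re : ℝ) : ℂ) := by
  rw [Complex.inv_eq_conj hz, add_assoc, Complex.add_conj]
  push_cast
  ring

theorem neg_sixth_le_re {z w : ℂ} (hz : ‖z‖ = 1) (hw : ‖w‖ = 1)
    (h : (1 + z + z⁻¹) * (1 + w + w⁻¹) = 2) : -1 / 6 ≤ z.re := by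
  rw [one_add_add_inv_eq_ofReal hz, one_add_add_inv_eq_ofReal hw] at h
  have h' : (1 + 2 * z.re) * (1 + 2 * w.re) = 2 := by exact_mod_cast h
  have hz1 := abs_le.1 (hz ▸ Complex.abs_re_le_norm z)
  have hw1 := abs_le.1 (hw ▸ Complex.abs_re_le_norm w)
  by_contra! hlt
  rcases le_or_gt 0 (1 + 2 * z.re) with h0 | h0
  -- The other factor is at most 3, so this one is at least 2/3.
  · nlinarith
  -- Two negative factors, each at least -1, have product at most 1.
  · nlinarith

/-- The witness is m/2 rounded down, m/2 - 1 or m/2 - 2, by m mod 4. The bound 2/5 is attained at m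
= 10. -/
theorem exists_coprime_near_half {m : ℕ} (h0 : m ≠ 0) (h1 : m ≠ 1) (h4 : m ≠ 4) (h6 : m ≠ 6) :
    ∃ j, j.Coprime m ∧ 2 * j ≤ m ∧ 5 * (m - 2 * j) ≤ 2 * m := by
  rcases eq_or_ne m 2 with rfl | h2
  · exact ⟨1, by norm_num⟩
  have h : m % 2 = 1 ∨ m % 4 = 0 ∨ m % 4 = 2 := by omega
  rcases h with h | h | h
  · refine ⟨m / 2, ?_, by omega, by omega⟩
    have : m = 2 * (m / 2) + 1 := by omega
    rw [this]
    generalize m / 2 = q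
    rw [show (2 * q + 1) / 2 = q by omega]
    simp
  · obtain ⟨q, rfl⟩ : ∃ q, m = 4 * (q + 1) := ⟨m / 4 - 1, by omega⟩
    refine ⟨2 * q + 1, ?_, by omega, by omega⟩
    rw [show 4 * (q + 1) = 2 + 2 * (2 * q + 1) by ring]
    simp
  · obtain ⟨q, rfl⟩ : ∃ q, m = 4 * (q + 1) + 2 := ⟨m / 4 - 1, by omega⟩
    refine ⟨2 * q + 1, ?_, by omega, by omega⟩
    rw [show 4 * (q + 1) + 2 = 2 ^ 2 + 2 * (2 * q + 1) by ring, Nat.coprime_add_mul_right_right]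
    exact Nat.Coprime.pow_right 2 (by simp)

theorem exists_coprime_lift {m N a : ℕ} (hN : N ≠ 0) (hmN : m ∣ N) (ha : a.Coprime m) :
    ∃ k : ℕ, k.Coprime N ∧ k ≡ a [MOD m] := by
  have : NeZero N := ⟨hN⟩
  obtain ⟨u, hu⟩ := ZMod.unitsMap_surjective hmN (ZMod.unitOfCoprime a ha)
  refine ⟨(u : ZMod N).val, ZMod.val_coe_unit_coprime u, ?_⟩
  rw [← ZMod.natCast_eq_natCast_iff]
  have := congrArg Units.val hu
  rw [ZMod.unitsMap_val, ZMod.coe_unitOfCoprime] at this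
  rw [← this, ZMod.natCast_val]

theorem cos_lt_neg_sixth {m j : ℕ} (h0 : m ≠ 0) (hjm : 2 * j ≤ m)
    (hj5 : 5 * (m - 2 * j) ≤ 2 * m) : Real.cos (2 * Real.pi * (j / m)) < -1 / 6 := by
  have hm : (0 : ℝ) < m := by exact_mod_cast Nat.pos_of_ne_zero h0
  have hjm' : (2 : ℝ) * j ≤ m := by exact_mod_cast hjm
  have hj5' : 5 * ((m : ℝ) - 2 * j) ≤ 2 * m := by
    have : 5 * m ≤ 2 * m + 10 * j := by omega
    have : 5 * (m : ℝ) ≤ 2 * m + 10 * j := by exact_mod_cast this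
    linarith
  set d := 1 - 2 * ((j : ℝ) / m) with hd
  have hd0 : 0 ≤ d := by
    rw [hd, ← mul_div_assoc, sub_nonneg, div_le_one hm]
    exact hjm'
  have hd1 : d ≤ 2 / 5 := by
    rw [hd, ← mul_div_assoc, sub_le_comm, le_div_iff₀ hm]
    linarith
  rw [show 2 * Real.pi * ((j : ℝ) / m) = Real.pi - Real.pi * d by rw [hd]; ring,
    Real.cos_pi_sub]
  have hcos := Real.one_sub_sq_div_two_le_cos (x := Real.pi * d)
  have hpi := Real.pi_lt_d2
  have hpi0 := Real.pi_pos
  have hpd : Real.pi * d ≤ 1.26 := by nlinarith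
  have hpd0 : 0 ≤ Real.pi * d := by positivity
  nlinarith

theorem orderOf_of_forall_re {N : ℕ} (hN : N ≠ 0) {ζ : ℂ} (hζ : ζ ^ N = 1)
    (h : ∀ k : ℕ, k.Coprime N → -1 / 6 ≤ (ζ ^ k).re) :
    orderOf ζ = 1 ∨ orderOf ζ = 4 ∨ orderOf ζ = 6 := by
  have hmN : orderOf ζ ∣ N := orderOf_dvd_of_pow_eq_one hζ
  have h0 : orderOf ζ ≠ 0 := (Nat.pos_of_dvd_of_pos hmN (Nat.pos_of_ne_zero hN)).ne'
  have hprim := IsPrimitiveRoot.orderOf ζ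
  generalize orderOf ζ = m at *
  by_contra! hne
  obtain ⟨h1, h4, h6⟩ := hne
  have : NeZero m := ⟨h0⟩
  obtain ⟨j, hj, hjm, hj5⟩ := exists_coprime_near_half h0 h1 h4 h6
  have hz := Complex.isPrimitiveRoot_exp_of_coprime j m h0 hj
  obtain ⟨a, -, ha, haz⟩ := hprim.isPrimitiveRoot_iff.1 hz
  -- The hypothesis concerns exponents coprime to N, while a is only coprime to m.
  obtain ⟨k, hk, hka⟩ := exists_coprime_lift hN hmN ha
  have hpow : ζ ^ k = ζ ^ a := by
    rw [pow_eq_pow_mod k hprim.pow_eq_one, pow_eq_pow_mod a hprim.pow_eq_one, hka]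
  have hexp : 2 * Real.pi * Complex.I * ((j : ℂ) / m) =
      ((2 * Real.pi * (j / m) : ℝ) : ℂ) * Complex.I := by
    push_cast
    ring
  have hre := h k hk
  rw [hpow, haz, hexp, Complex.exp_ofReal_mul_I_re] at hre
  exact absurd hre (cos_lt_neg_sixth h0 hjm hj5).not_ge

theorem one_add_add_inv_of_orderOf_four {z : ℂ} (h : orderOf z = 4) : 1 + z + z⁻¹ = 1 := by
  have hp := h ▸ IsPrimitiveRoot.orderOf z
  have h0 : z ≠ 0 := hp.ne_zero (by norm_num)
  have h2 : z ^ 2 ≠ 1 := hp.pow_ne_one_of_pos_of_lt (by norm_num) (by norm_num)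
  have h3 : z ^ 2 + 1 = 0 := by
    apply (mul_eq_zero.1 _).resolve_left (sub_ne_zero.2 h2)
    linear_combination hp.pow_eq_one
  field_simp
  linear_combination h3

theorem one_add_add_inv_of_orderOf_six {z : ℂ} (h : orderOf z = 6) : 1 + z + z⁻¹ = 2 := by
  have hp := h ▸ IsPrimitiveRoot.orderOf z
  have h0 : z ≠ 0 := hp.ne_zero (by norm_num)
  have h2 : z ^ 2 - 1 ≠ 0 :=
    sub_ne_zero.2 (hp.pow_ne_one_of_pos_of_lt (by norm_num) (by norm_num))
  have h3 : z ^ 3 - 1 ≠ 0 :=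
    sub_ne_zero.2 (hp.pow_ne_one_of_pos_of_lt (by norm_num) (by norm_num))
  have h1 : z + 1 ≠ 0 := fun e => h2 (by linear_combination (z - 1) * e)
  have h4 : z ^ 2 - z + 1 = 0 := by
    apply (mul_eq_zero.1 _).resolve_left (mul_ne_zero h3 h1)
    linear_combination hp.pow_eq_one
  field_simp
  linear_combination h4

theorem four_dvd_and_six_dvd_of_product_eq_two {N : ℕ} (hN : 0 < N) {ζ η : ℂ} (hζ : ζ ^ N = 1)
    (hη : η ^ N = 1) (h : (1 + ζ + ζ⁻¹) * (1 + η + η⁻¹) = 2) : 4 ∣ N ∧ 6 ∣ N := by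
  have norm_pow : ∀ z : ℂ, z ^ N = 1 → ∀ k, ‖z ^ k‖ = 1 := fun z hz k => by
    rw [norm_pow, Complex.norm_eq_one_of_pow_eq_one hz hN.ne', one_pow]
  have hoζ := orderOf_of_forall_re hN.ne' hζ fun k hk =>
    neg_sixth_le_re (norm_pow ζ hζ k) (norm_pow η hη k) (conjugate_product_eq_two hN hζ hη h hk)
  have hoη := orderOf_of_forall_re hN.ne' hη fun k hk =>
    neg_sixth_le_re (norm_pow η hη k) (norm_pow ζ hζ k)
      (conjugate_product_eq_two hN hη hζ ((mul_comm _ _).trans h) hk)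
  have hdζ : orderOf ζ ∣ N := orderOf_dvd_of_pow_eq_one hζ
  have hdη : orderOf η ∣ N := orderOf_dvd_of_pow_eq_one hη
  have val : ∀ z : ℂ, orderOf z = 1 → 1 + z + z⁻¹ = 3 := by
    intro z hz
    rw [orderOf_eq_one_iff.1 hz]
    norm_num
  rcases hoζ with a | a | a <;> rcases hoη with b | b | b <;>
    simp only [a, b, val, one_add_add_inv_of_orderOf_four, one_add_add_inv_of_orderOf_six]
      at h hdζ hdη <;>
    first | exact ⟨hdζ, hdη⟩ | exact ⟨hdη, hdζ⟩ | (exfalso; norm_num at h)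

/-! ### Construction and conclusion -/

theorem exists_solution_of_six_dvd {n : ℕ} (h : 6 ∣ n + 1) :
    ∃ X : Matrix (Fin n) (Fin n) ℤ, X ≠ 0 ∧ HasNeighbourSumProperty X := by
  -- Up to scale, f and g are sin(πk/3) and sin(πk/2); they vanish at multiples of 3 and of 2.
  let f : ℕ → ℤ := fun k => if k % 6 = 1 ∨ k % 6 = 2 then 1 else
    if k % 6 = 4 ∨ k % 6 = 5 then -1 else 0
  let g : ℕ → ℤ := fun k => if k % 4 = 1 then 1 else if k % 4 = 3 then -1 else 0
  have hf : ∀ k, f k + f (k + 1) + f (k + 2) = 2 * f (k + 1) := by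
    intro k
    simp only [f]
    split_ifs <;> omega
  have hg : ∀ k, g k + g (k + 1) + g (k + 2) = g (k + 1) := by
    intro k
    simp only [g]
    split_ifs <;> omega
  have hfn : f (n + 1) = 0 := by simp only [f]; split_ifs <;> omega
  have hgn : g (n + 1) = 0 := by simp only [g]; split_ifs <;> omega
  let v : Fin n → ℤ := fun k => f (k + 1)
  let w : Fin n → ℤ := fun k => g (k + 1)
  have hv : bandMatrix n ℤ *ᵥ v = (2 : ℤ) • v := by
    ext i
    exact (bandMatrix_mulVec_apply f rfl hfn i).trans (hf i)
  have hw : w ᵥ* bandMatrix n ℤ = w := by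
    rw [← bandMatrix_transpose, Matrix.vecMul_transpose]
    ext i
    exact (bandMatrix_mulVec_apply g rfl hgn i).trans (hg i)
  have hn : 0 < n := by omega
  refine ⟨Matrix.vecMulVec v w, fun e => ?_, ?_⟩
  · have := congrFun (congrFun e ⟨0, hn⟩) ⟨0, hn⟩
    simp [Matrix.vecMulVec, v, w, f, g] at this
  · rw [hasNeighbourSumProperty_iff, Matrix.mul_vecMulVec, hv, Matrix.vecMulVec_mul, hw,
      Matrix.smul_vecMulVec]

theorem mainTheorem1 (n : ℕ) :
    (∃ X : Matrix (Fin n) (Fin n) ℤ, X ≠ 0 ∧ HasNeighbourSumProperty X) ↔ 6 ∣ n + 1 := by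
  refine ⟨?_, exists_solution_of_six_dvd⟩
  rintro ⟨X, hX, hsum⟩
  rw [hasNeighbourSumProperty_iff] at hsum
  have hX' : X.map (Int.castRingHom ℂ) ≠ 0 := by
    intro e
    apply hX
    ext i j
    simpa using congrFun (congrFun e i) j
  have hsum' : bandMatrix n ℂ * X.map (Int.castRingHom ℂ) * bandMatrix n ℂ =
      (2 : ℂ) • X.map (Int.castRingHom ℂ) := by
    rw [← bandMatrix_map_intCast, ← Matrix.map_mul, ← Matrix.map_mul, hsum]
    ext i j
    simp only [Matrix.map_apply, Matrix.smul_apply, smul_eq_mul, map_mul, map_ofNat]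
  obtain ⟨ζ, η, hζ, hη, h⟩ := exists_roots_of_unity_of_band_eq hX' hsum'
  have := four_dvd_and_six_dvd_of_product_eq_two (by omega) hζ hη h
  omega
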